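/- Let $A$ be a unital $C^*$-algebra of real rank zero (the invertible self-adjoint elements are norm dense in the self-adjoint elements) satisfying the following condition $(\dagger)$: for every $n\in\mathbb{N}$ and every non-zero projection $p\in A$ there are non-zero pairwise orthogonal subprojections $p_1,\dots,p_n$ of $p$ in $A$ such that $p\in\overline{Ap_iA}$ for all $i$, where $\overline{AxA}$ denotes the closed two-sided ideal generated by $x$. Let $\beta:A\to A$ be an injective (not necessarily unital) $*$-endomorphism such that $\beta(A)$ is a hereditary sub-$C^*$-algebra of $A$. Let $A\times_\beta\mathbb{N}=C^*(A,V)$ be the Stacey crossed product, that is, the $C^*$-algebra generated by the universal covariant representation of $(A,\beta)$, where a covariant representation consists of a unital representation $\pi$ of $A$ on a Hilbert space and an isometry $V$ with $\pi(\beta(a))=V\pi(a)V^*$ for all $a\in A$; we regard elements of $A$ as elements of $A\times_\beta\mathbb{N}$ through the canonical map. Suppose that there is no closed two-sided ideal $I$ of $A$ with $I\neq 0$, $I\neq A$ and $\beta(I)\subseteq I$. Then for every non-zero projection $p\in A$ there exist a projection $q\in A$ that is full (i.e. $\overline{AqA}=A$) and an element $c\in A\times_\beta\mathbb{N}$ such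 that $q=cpc^*$. -/

import Mathlib

open scoped ENNReal

universe u

noncomputable section

/-- A sub-C*-algebra is hereditary if it is norm closed and contains every `a` with
`0 ≤ a ≤ b` for some element `b` of it. -/
def IsHereditarySubalgebra {A : Type u} [CStarAlgebra A] [PartialOrder A] [StarOrderedRing A]
    (S : NonUnitalStarSubalgebra ℂ A) : Prop :=
  IsClosed (S : Set A) ∧ ∀ a b : A, 0 ≤ a → a ≤ b → b ∈ S → a ∈ S

/-- A unital C*-algebra has real rank zero if the invertible self-adjoint elements are norm dense
in the self-adjoint elements. -/
def HasRealRankZero (A : Type u) [CStarAlgebra A] : Prop :=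
  ∀ a : A, IsSelfAdjoint a → ∀ ε : ℝ, 0 < ε → ∃ b : A, IsSelfAdjoint b ∧ IsUnit b ∧ ‖a - b‖ < ε

/-- The closed two-sided ideal generated by `x`: the closed linear span of `A x A`. -/
def closedIdealOf {A : Type u} [CStarAlgebra A] (x : A) : Submodule ℂ A :=
  (Submodule.span ℂ {y : A | ∃ a b : A, y = a * x * b}).topologicalClosure

/-- An element is full if it generates the whole algebra as a closed two-sided ideal. -/
def IsFullElement {A : Type u} [CStarAlgebra A] (x : A) : Prop :=
  closedIdealOf x = ⊤

/-- For every `n` and every nonzero projection `p` there are `n` nonzero, pairwise orthogonal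
subprojections of `p` (for projections, `e ≤ p` means `p * e = e`), each of which generates a
closed ideal containing `p`. -/
def SatisfiesDagger (A : Type u) [CStarAlgebra A] : Prop :=
  ∀ (n : ℕ) (p : A), IsStarProjection p → p ≠ 0 →
    ∃ e : Fin n → A,
      (∀ i, IsStarProjection (e i) ∧ e i ≠ 0 ∧ p * e i = e i ∧ p ∈ closedIdealOf (e i)) ∧
      ∀ i j, i ≠ j → e i * e j = 0

/-- A Stacey covariant representation of `(A, β)` for unital `A`, on a nonzero Hilbert space:
a representation `π` (non-degenerate, which for unital `A` means unital) and an isometry `V` with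
`π (β a) = V π(a) V*`. -/
structure StaceyCovariantRep {A : Type u} [CStarAlgebra A] (β : A →⋆ₙₐ[ℂ] A) : Type (u + 1) where
  H : Type u
  [normed : NormedAddCommGroup H]
  [inner : InnerProductSpace ℂ H]
  [complete : CompleteSpace H]
  [nontrivial : Nontrivial H]
  π : A →⋆ₐ[ℂ] (H →L[ℂ] H)
  V : H →L[ℂ] H
  isometry : star V * V = 1
  covariant : ∀ a : A, π (β a) = V * π a * star V

attribute [instance] StaceyCovariantRep.normed StaceyCovariantRep.inner
  StaceyCovariantRep.complete StaceyCovariantRep.nontrivial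

namespace Stacey

variable {A : Type u} [CStarAlgebra A] (β : A →⋆ₙₐ[ℂ] A)

/-- The C*-algebra of bounded families of operators, indexed by all covariant representations on
Hilbert spaces in the universe of `A` (every cyclic covariant representation is unitarily
equivalent to one of these). It is the algebra of block diagonal operators on the direct sum of all
these representations. -/
abbrev Ambient : Type (u + 1) :=
  lp (fun R : StaceyCovariantRep β => R.H →L[ℂ] R.H) ∞

theorem norm_V_le {β : A →⋆ₙₐ[ℂ] A} (R : StaceyCovariantRep β) : ‖R.V‖ ≤ 1 := by
  have h := CStarRing.norm_star_mul_self (x := R.V)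
  rw [R.isometry, norm_one] at h
  nlinarith [norm_nonneg R.V]

/-- The direct sum of all covariant representations, on `A`. -/
def ambientι : A →⋆ₐ[ℂ] Ambient β where
  toFun a := ⟨fun R => R.π a, memℓp_infty ⟨‖a‖, by
    rintro _ ⟨R, rfl⟩
    exact NonUnitalStarAlgHom.norm_apply_le R.π a⟩⟩
  map_one' := by ext1; funext R; exact map_one R.π
  map_mul' a b := by ext1; funext R; exact map_mul R.π a b
  map_zero' := by ext1; funext R; exact map_zero R.π
  map_add' a b := by ext1; funext R; exact map_add R.π a b
  commutes' z := by ext1; funext R; exact AlgHomClass.commutes R.π z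
  map_star' a := by ext1; funext R; exact map_star R.π a

/-- The direct sum of the isometries of all covariant representations. -/
def ambientV : Ambient β :=
  ⟨fun R => R.V, memℓp_infty ⟨1, by
    rintro _ ⟨R, rfl⟩
    exact norm_V_le R⟩⟩

/-- The Stacey crossed product `A ×_β ℕ`: the C*-algebra generated by the elements
`ι(a) V ^ n (V*) ^ m` for the universal covariant representation `(ι, V)`. -/
def CrossedProduct : StarSubalgebra ℂ (Ambient β) :=
  (StarAlgebra.adjoin ℂ
    {x : Ambient β | ∃ (a : A) (n m : ℕ),
      x = ambientι β a * ambientV β ^ n * star (ambientV β) ^ m}).topologicalClosure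

instance : Ring (CrossedProduct β) := inferInstance

instance : StarRing (CrossedProduct β) := inferInstance

instance : Semigroup (CrossedProduct β) := MonoidWithZero.toSemigroupWithZero.toSemigroup

theorem ambientι_mem (a : A) : ambientι β a ∈ CrossedProduct β :=
  StarSubalgebra.le_topologicalClosure _
    (StarAlgebra.subset_adjoin ℂ _ ⟨a, 0, 0, by simp⟩)

theorem ambientV_mem : ambientV β ∈ CrossedProduct β :=
  StarSubalgebra.le_topologicalClosure _
    (StarAlgebra.subset_adjoin ℂ _ ⟨1, 1, 0, by simp⟩)

/-- The canonical homomorphism `A → A ×_β ℕ`. -/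
def ι : A →⋆ₐ[ℂ] CrossedProduct β :=
  (ambientι β).codRestrict (CrossedProduct β) (ambientι_mem β)

/-- The canonical isometry of `A ×_β ℕ`. -/
def V : CrossedProduct β := ⟨ambientV β, ambientV_mem β⟩

theorem V_isometry : star (V β) * V β = 1 := by
  apply Subtype.ext
  ext1
  funext R
  exact R.isometry

theorem ι_covariant (a : A) : ι β (β a) = V β * ι β a * star (V β) := by
  apply Subtype.ext
  ext1
  funext R
  exact R.covariant a

end Stacey

end

/-! ### Closed ideals generated by one element and by the orbit of `p`. -/

section ClosedIdeal

variable {A : Type u} [CStarAlgebra A]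

/-! The orbit of `p` under `β` generates a closed invariant ideal, hence all of `A`; as `A` is
unital, finitely many `β^[k] p`, `k < n`, suffice (`exists_forall_isFullElement_of_iterate_mem`).
Condition (†) splits off orthogonal `e k ≤ p` whose ideals contain `p`, so the `β^[k] (e k)` still
generate `A`. Real rank zero merges them into one projection `q = ∑ t k * β^[k] (e k) * star (t k)`
with all of them in its ideal (`HasRealRankZero.exists_sum_conj_isStarProjection`), so `q` is full.
In the crossed product `β^[k] (e k)` is `V^k (e k) V*^k`. With `c = ∑ t k * V^k * e k`,
orthogonality of the `e k` kills the cross terms of `c p c*`, leaving `q`. -/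

theorem mul_mul_mem_closedIdealOf (x a b : A) : a * x * b ∈ closedIdealOf x :=
  Submodule.le_topologicalClosure _ (Submodule.subset_span ⟨a, b, rfl⟩)

/-- A continuous linear map sends the closed span of `s` into a closed submodule as soon as it
sends `s` there. -/
theorem map_mem_of_mem_closure_span {s : Set A} {J : Submodule ℂ A} (hJ : IsClosed (J : Set A))
    (φ : A →ₗ[ℂ] A) (hφ : Continuous φ) (h : ∀ y ∈ s, φ y ∈ J) {z : A}
    (hz : z ∈ (Submodule.span ℂ s).topologicalClosure) : φ z ∈ J := by
  have hle : (Submodule.span ℂ s).topologicalClosure ≤ J.comap φ :=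
    Submodule.topologicalClosure_minimal _ (Submodule.span_le.2 h) (hJ.preimage hφ)
  exact hle hz

theorem isClosed_closedIdealOf (x : A) : IsClosed (closedIdealOf x : Set A) :=
  Submodule.isClosed_topologicalClosure _

theorem mul_mul_mem_of_mem_closedIdealOf {x z : A} (hz : z ∈ closedIdealOf x) (a b : A) :
    a * z * b ∈ closedIdealOf x := by
  refine map_mem_of_mem_closure_span (isClosed_closedIdealOf x)
    ((LinearMap.mulRight ℂ b).comp (LinearMap.mulLeft ℂ a))
    (show Continuous fun y => a * y * b by fun_prop) ?_ hz
  rintro _ ⟨c, d, rfl⟩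
  have : a * (c * x * d) * b = (a * c) * x * (d * b) := by noncomm_ring
  simpa [this] using mul_mul_mem_closedIdealOf x (a * c) (d * b)

theorem mem_closedIdealOf_trans {x y z : A} (hxy : x ∈ closedIdealOf y)
    (hyz : y ∈ closedIdealOf z) : x ∈ closedIdealOf z := by
  refine map_mem_of_mem_closure_span (isClosed_closedIdealOf z) LinearMap.id continuous_id ?_ hxy
  rintro _ ⟨c, d, rfl⟩
  exact mul_mul_mem_of_mem_closedIdealOf hyz c d

theorem map_mem_closedIdealOf (φ : A →⋆ₙₐ[ℂ] A) {x y : A} (h : x ∈ closedIdealOf y) :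
    φ x ∈ closedIdealOf (φ y) := by
  refine map_mem_of_mem_closure_span (isClosed_closedIdealOf (φ y)) (φ : A →ₗ[ℂ] A)
    (AddMonoidHomClass.continuous_of_bound φ 1 fun x => by
      simpa using NonUnitalStarAlgHom.norm_apply_le φ x) ?_ h
  rintro _ ⟨c, d, rfl⟩
  simpa using mul_mul_mem_closedIdealOf (φ y) (φ c) (φ d)

theorem iterate_map_mem_closedIdealOf (φ : A →⋆ₙₐ[ℂ] A) {x y : A} (h : x ∈ closedIdealOf y)
    (k : ℕ) : φ^[k] x ∈ closedIdealOf (φ^[k] y) := by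
  induction k with
  | zero => exact h
  | succ k ih =>
    rw [Function.iterate_succ_apply', Function.iterate_succ_apply']
    exact map_mem_closedIdealOf φ ih

theorem isFullElement_of_isUnit_mem {x s : A} (hs : IsUnit s) (h : s ∈ closedIdealOf x) :
    IsFullElement x := by
  refine eq_top_iff.2 fun y _ => ?_
  obtain ⟨v, rfl⟩ := hs
  simpa using mul_mul_mem_of_mem_closedIdealOf h 1 (↑v⁻¹ * y)

/-- A projection that is approximately absorbed by `y` lies in the closed ideal of `y`. -/
theorem IsStarProjection.mem_closedIdealOf_of_norm_lt {f y : A} (hf : IsStarProjection f)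
    (h : ‖f - f * y * f‖ < 1) : f ∈ closedIdealOf y := by
  -- `w = 1 - (f - f y f)` is invertible and `f w = f y f`, so `f = f y f w⁻¹`.
  obtain ⟨w, hw⟩ := isUnit_one_sub_of_norm_lt_one h
  have hff : f * f = f := hf.isIdempotentElem
  have h1 : f * (w : A) = f * y * f := by
    rw [hw]
    have : f * (1 - (f - f * y * f)) = f - f * f + (f * f) * y * f := by noncomm_ring
    rw [this, hff, sub_self, zero_add]
  have h2 : f = f * y * (f * ↑w⁻¹) := by
    rw [← mul_assoc, ← h1, mul_assoc, Units.mul_inv, mul_one]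
  rw [h2]
  exact mul_mul_mem_closedIdealOf y f _

/-- If `A` has no proper nonzero closed `β`-invariant ideal, then finitely many translates of a
nonzero element generate `A`. -/
theorem exists_forall_isFullElement_of_iterate_mem (β : A →⋆ₙₐ[ℂ] A)
    (hideal : ∀ I : TwoSidedIdeal A, IsClosed (I : Set A) → (∀ a ∈ I, β a ∈ I) →
      I = ⊥ ∨ I = ⊤)
    {p : A} (hp0 : p ≠ 0) :
    ∃ n : ℕ, ∀ y : A, (∀ k < n, β^[k] p ∈ closedIdealOf y) → IsFullElement y := by
  let S : Set A := {z | ∃ (k : ℕ) (a b : A), z = a * β^[k] p * b}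
  let J : Submodule ℂ A := (Submodule.span ℂ S).topologicalClosure
  have hJc : IsClosed (J : Set A) := Submodule.isClosed_topologicalClosure _
  have hSJ : ∀ z ∈ S, z ∈ J := fun z hz =>
    Submodule.le_topologicalClosure _ (Submodule.subset_span hz)
  have hleft : ∀ a z : A, z ∈ J → a * z ∈ J := fun a z hz => by
    refine map_mem_of_mem_closure_span hJc (LinearMap.mulLeft ℂ a)
      (show Continuous fun y => a * y by fun_prop) ?_ hz
    rintro _ ⟨k, c, d, rfl⟩
    exact hSJ _ ⟨k, a * c, d, by simp [mul_assoc]⟩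
  have hright : ∀ z a : A, z ∈ J → z * a ∈ J := fun z a hz => by
    refine map_mem_of_mem_closure_span hJc (LinearMap.mulRight ℂ a)
      (show Continuous fun y => y * a by fun_prop) ?_ hz
    rintro _ ⟨k, c, d, rfl⟩
    exact hSJ _ ⟨k, c, d * a, by simp [mul_assoc]⟩
  have hβJ : ∀ z ∈ J, β z ∈ J := fun z hz => by
    refine map_mem_of_mem_closure_span hJc (β : A →ₗ[ℂ] A)
      (AddMonoidHomClass.continuous_of_bound β 1 fun x => by
        simpa using NonUnitalStarAlgHom.norm_apply_le β x) ?_ hz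
    rintro _ ⟨k, c, d, rfl⟩
    exact hSJ _ ⟨k + 1, β c, β d, by simp [Function.iterate_succ_apply', -Function.iterate_succ]⟩
  let I : TwoSidedIdeal A := TwoSidedIdeal.mk' (J : Set A) J.zero_mem
    (fun hx hy => J.add_mem hx hy) (fun hx => J.neg_mem hx) (fun {x y} hy => hleft x y hy)
    (fun {x y} hx => hright x y hx)
  have hmem : ∀ z, z ∈ I ↔ z ∈ J := fun z => TwoSidedIdeal.mem_mk' _ _ _ _ _ _ z
  have hIJ : (I : Set A) = (J : Set A) := Set.ext hmem
  have hpJ : p ∈ J := hSJ _ ⟨0, 1, 1, by simp⟩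
  have hone : (1 : A) ∈ J := by
    rcases hideal I (hIJ ▸ hJc) (fun a ha => (hmem _).2 (hβJ a ((hmem a).1 ha))) with h | h
    · exact absurd ((TwoSidedIdeal.mem_bot A).1 (h ▸ (hmem p).2 hpJ)) hp0
    · exact (hmem 1).1 (h ▸ trivial)
  -- An element of the algebraic span at distance less than 1 from the unit is invertible and
  -- involves only finitely many translates.
  obtain ⟨s, hs, hdist⟩ := Metric.mem_closure_iff.1
    (show (1 : A) ∈ closure ((Submodule.span ℂ S : Submodule ℂ A) : Set A) from hone) 1 one_pos
  have hunit : IsUnit s := by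
    have := isUnit_one_sub_of_norm_lt_one (x := 1 - s) (by rwa [← dist_eq_norm])
    simpa using this
  have hfin : ∃ n : ℕ, ∀ y : A, (∀ k < n, β^[k] p ∈ closedIdealOf y) → s ∈ closedIdealOf y := by
    refine Submodule.span_induction (p := fun s _ => ∃ n : ℕ, ∀ y : A,
      (∀ k < n, β^[k] p ∈ closedIdealOf y) → s ∈ closedIdealOf y) ?_ ?_ ?_ ?_ hs
    · rintro _ ⟨k, a, b, rfl⟩
      exact ⟨k + 1, fun y hy => mul_mul_mem_of_mem_closedIdealOf (hy k k.lt_succ_self) a b⟩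
    · exact ⟨0, fun y _ => zero_mem _⟩
    · rintro x z _ _ ⟨n, hn⟩ ⟨m, hm⟩
      exact ⟨max n m, fun y hy => add_mem
        (hn y fun k hk => hy k (hk.trans_le (le_max_left n m)))
        (hm y fun k hk => hy k (hk.trans_le (le_max_right n m)))⟩
    · rintro c x _ ⟨n, hn⟩
      exact ⟨n, fun y hy => Submodule.smul_mem _ c (hn y hy)⟩
  obtain ⟨n, hn⟩ := hfin
  exact ⟨n, fun y hy => isFullElement_of_isUnit_mem hunit (hn y hy)⟩

end ClosedIdeal

/-! ### Merging projections in real rank zero. -/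

section RealRankZero

variable {A : Type u} [CStarAlgebra A] [PartialOrder A] [StarOrderedRing A]

/-- An invertible self-adjoint element has a positive spectral projection. -/
theorem exists_isStarProjection_of_isUnit {b : A} (hb : IsSelfAdjoint b) (hu : IsUnit b) :
    ∃ g : A, IsStarProjection g ∧ 0 ≤ g * b * g ∧ (1 - g) * b * (1 - g) ≤ 0 := by
  -- The jump at 0 misses the spectrum of an invertible element, so `χ` is continuous there.
  let χ : ℝ → ℝ := fun t => if 0 < t then 1 else 0
  have h0 : ∀ t ∈ spectrum ℝ b, t ≠ 0 := fun t ht h => by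
    subst h; exact (spectrum.zero_notMem_iff ℝ).2 hu ht
  have hχ : ContinuousOn χ (spectrum ℝ b) := by
    intro t ht
    apply ContinuousAt.continuousWithinAt
    rcases lt_or_gt_of_ne (h0 t ht) with h | h
    · refine (continuousAt_const (y := (0 : ℝ))).congr ?_
      filter_upwards [eventually_lt_nhds h] with s hs
      simp [χ, hs.not_gt]
    · refine (continuousAt_const (y := (1 : ℝ))).congr ?_
      filter_upwards [eventually_gt_nhds h] with s hs
      simp [χ, hs]
  have hχ' : ContinuousOn (fun t => 1 - χ t) (spectrum ℝ b) := continuousOn_const.sub hχ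
  have hsub : 1 - cfc χ b = cfc (fun t => 1 - χ t) b := by
    rw [cfc_sub (fun _ => (1 : ℝ)) χ b, cfc_const_one ℝ b]
  have key : ∀ ψ : ℝ → ℝ, ContinuousOn ψ (spectrum ℝ b) →
      cfc ψ b * b * cfc ψ b = cfc (fun t => ψ t * t * ψ t) b := fun ψ hψ => by
    rw [cfc_mul (fun t => ψ t * t) ψ b (hψ.mul continuousOn_id) hψ,
      cfc_mul ψ (fun t => t) b hψ continuousOn_id, cfc_id' ℝ b]
  refine ⟨cfc χ b, ⟨?_, cfc_predicate χ b⟩, ?_, ?_⟩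
  · change cfc χ b * cfc χ b = cfc χ b
    rw [← cfc_mul χ χ b hχ hχ]
    congr 1; funext t; simp [χ]
  · rw [key χ hχ]
    refine cfc_nonneg fun t _ => ?_
    by_cases h : 0 < t <;> simp [χ, h, le_of_lt]
  · rw [hsub, key _ hχ']
    refine cfc_nonpos _ b fun t _ => ?_
    by_cases h : 0 < t
    · simp [χ, h]
    · simpa [χ, h] using not_lt.1 h

/-- In real rank zero, a self-adjoint element is bounded below on the range of some projection and
bounded above on its complement. -/
theorem HasRealRankZero.exists_isStarProjection (hrr : HasRealRankZero A) {a : A}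
    (ha : IsSelfAdjoint a) {ε : ℝ} (hε : 0 < ε) :
    ∃ g : A, IsStarProjection g ∧ ε • g ≤ g * a * g ∧
      (1 - g) * a * (1 - g) ≤ (3 * ε) • (1 - g) := by
  -- Splitting at height `2 * ε` with an approximation error `ε` gives the bounds `ε` and `3 * ε`.
  have hsa : IsSelfAdjoint (a - (2 * ε) • (1 : A)) :=
    ha.sub (.smul (IsSelfAdjoint.all (2 * ε)) (.one A))
  obtain ⟨b, hb, hu, hab⟩ := hrr _ hsa ε hε
  obtain ⟨g, hg, h1, h2⟩ := exists_isStarProjection_of_isUnit hb hu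
  have hd : IsSelfAdjoint (a - (2 * ε) • (1 : A) - b) := hsa.sub hb
  have hup : a - (2 * ε) • (1 : A) - b ≤ ε • (1 : A) := by
    refine hd.le_algebraMap_norm_self.trans ?_
    rw [← Algebra.algebraMap_eq_smul_one ε]
    exact algebraMap_mono A hab.le
  have hlow : -(ε • (1 : A)) ≤ a - (2 * ε) • (1 : A) - b := by
    refine le_trans ?_ hd.neg_algebraMap_norm_le_self
    rw [← Algebra.algebraMap_eq_smul_one ε]
    exact neg_le_neg (algebraMap_mono A hab.le)
  have hcompl : IsStarProjection (1 - g) := hg.one_sub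
  refine ⟨g, hg, ?_, ?_⟩
  · have h3 := IsSelfAdjoint.conjugate_le_conjugate hlow hg.isSelfAdjoint
    have e1 : g * (-(ε • (1 : A))) * g = -(ε • g) := by
      simp [hg.isIdempotentElem.eq]
    have e2 : g * (a - (2 * ε) • (1 : A) - b) * g = g * a * g - (2 * ε) • g - g * b * g := by
      simp [mul_sub, sub_mul, hg.isIdempotentElem.eq]
    rw [e1, e2] at h3
    have h4 := add_le_add h3 h1
    have h5 := add_le_add_left h4 ((2 * ε) • g)
    convert h5 using 1 <;> module
  · have h3 := IsSelfAdjoint.conjugate_le_conjugate hup hcompl.isSelfAdjoint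
    set k := 1 - g
    have e1 : k * (ε • (1 : A)) * k = ε • k := by
      simp [hcompl.isIdempotentElem.eq]
    have e2 : k * (a - (2 * ε) • (1 : A) - b) * k = k * a * k - (2 * ε) • k - k * b * k := by
      simp [mul_sub, sub_mul, hcompl.isIdempotentElem.eq]
    rw [e1, e2] at h3
    have h4 := add_le_add h3 h2
    have h5 := add_le_add_left h4 ((2 * ε) • k)
    convert h5 using 1 <;> module

/-- A positive element cut down by a projection `f` is of the form `s * f * star s`. -/
theorem exists_eq_mul_mul_star_of_nonneg {f m : A} (hf : IsStarProjection f) (hm : 0 ≤ m) :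
    ∃ s : A, f * m * f = s * f * star s := by
  have hb : 0 ≤ f * m * f := hf.isSelfAdjoint.conjugate_nonneg hm
  set b := f * m * f with hbdef
  have hff : f * f = f := hf.isIdempotentElem
  have hs : star (CFC.sqrt b) = CFC.sqrt b := (CFC.sqrt_nonneg b).isSelfAdjoint
  have hzero : CFC.sqrt b * (1 - f) = 0 := by
    rw [← CStarRing.star_mul_self_eq_zero_iff, star_mul, hs, hf.one_sub.isSelfAdjoint.star_eq]
    have : (1 - f) * CFC.sqrt b * (CFC.sqrt b * (1 - f)) =
        (1 - f) * (CFC.sqrt b * CFC.sqrt b) * (1 - f) := by noncomm_ring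
    rw [this, CFC.sqrt_mul_sqrt_self b hb, hbdef]
    have : (1 - f) * (f * m * f) = (f - f * f) * m * f := by noncomm_ring
    rw [this, hff, sub_self]; simp
  have hsf : CFC.sqrt b * f = CFC.sqrt b := by
    rw [mul_sub, mul_one, sub_eq_zero] at hzero
    exact hzero.symm
  exact ⟨CFC.sqrt b, by rw [hs, hsf, CFC.sqrt_mul_sqrt_self b hb]⟩

/-- In real rank zero, a projection `e` can be enlarged by a projection that is subequivalent to
`f`, so that the sum generates `f` as well. -/
theorem HasRealRankZero.exists_add_conj_isStarProjection (hrr : HasRealRankZero A) {e f : A}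
    (he : IsStarProjection e) (hf : IsStarProjection f) :
    ∃ t : A, IsStarProjection (e + t * f * star t) ∧
      e ∈ closedIdealOf (e + t * f * star t) ∧ f ∈ closedIdealOf (e + t * f * star t) := by
  have hff : f * f = f := hf.isIdempotentElem
  have hee : e * e = e := he.isIdempotentElem
  have hfs : star f = f := hf.isSelfAdjoint
  have hes : star e = e := he.isSelfAdjoint
  set r := 1 - e with hr
  have hrp : IsStarProjection r := he.one_sub
  have hrr' : r * r = r := hrp.isIdempotentElem
  have hrs : star r = r := hrp.isSelfAdjoint
  have her : e * r = 0 := by rw [hr, mul_sub, mul_one, hee, sub_self]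
  have hre : r * e = 0 := by rw [hr, sub_mul, one_mul, hee, sub_self]
  -- `a = f - f e f` measures how far `e` is from absorbing `f`. The choice `ε = 1/4` below makes `3
  -- * ε < 1`.
  set a := f * r * f with ha
  have ha0 : 0 ≤ a := hf.isSelfAdjoint.conjugate_nonneg hrp.nonneg
  obtain ⟨g, hg, hlow, hup⟩ :=
    hrr.exists_isStarProjection ha0.isSelfAdjoint (ε := 1 / 4) (by norm_num)
  have hgg : g * g = g := hg.isIdempotentElem
  have hgs : star g = g := hg.isSelfAdjoint
  -- Adding `1 - g` makes the compression of `a` to `g` invertible in `A`; cutting `d⁻¹` by `g`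
  -- gives `m`, the inverse of `g a g` in the corner `g A g`.
  set d := g * a * g + (1 - g) with hd
  have hdlow : (1 / 4 : ℝ) • (1 : A) ≤ d := by
    have h1 : (1 / 4 : ℝ) • (1 - g) ≤ 1 - g := by
      have h := smul_le_smul_of_nonneg_right (show (1 / 4 : ℝ) ≤ 1 by norm_num)
        hg.one_sub.nonneg
      simpa using h
    have h2 := add_le_add hlow h1
    convert h2 using 1
    module
  have hdunit : IsUnit d := by
    refine CStarAlgebra.isUnit_of_le ((1 / 4 : ℝ) • (1 : A)) hdlow ?_
    rw [← Algebra.algebraMap_eq_smul_one]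
    exact IsStrictlyPositive.iff_of_unital.2 ⟨algebraMap_nonneg A (by norm_num),
      (IsUnit.mk0 (1 / 4 : ℝ) (by norm_num)).map (algebraMap ℝ A)⟩
  have hd0 : 0 ≤ d := le_trans (smul_nonneg (by norm_num) zero_le_one) hdlow
  obtain ⟨v, hv⟩ := hdunit
  have hdg : d * g = g * a * g := by
    rw [hd, add_mul, sub_mul, one_mul, hgg, sub_self, add_zero, mul_assoc (g * a), hgg]
  have hgd : g * d = g * a * g := by
    rw [hd, mul_add, mul_sub, mul_one, hgg, sub_self, add_zero, ← mul_assoc, ← mul_assoc, hgg]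
  set w : A := ↑v⁻¹ with hw
  have hdw : d * w = 1 := by rw [← hv]; exact Units.mul_inv v
  have hwd : w * d = 1 := by rw [← hv]; exact Units.inv_mul v
  have hw0 : 0 ≤ w := by
    have h := star_left_conjugate_nonneg hd0 w
    rwa [mul_assoc, hdw, mul_one, star_nonneg_iff] at h
  have hgw : g * w = w * g := by
    calc g * w = w * (d * g) * w := by rw [← mul_assoc w, hwd, one_mul]
      _ = w * (g * d) * w := by rw [hdg, hgd]
      _ = w * g := by rw [mul_assoc w, mul_assoc g, hdw, mul_one]
  set m := g * w * g with hm
  have hm0 : 0 ≤ m := hg.isSelfAdjoint.conjugate_nonneg hw0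
  have hms : star m = m := hm0.isSelfAdjoint
  have hgm : g * m = m := by rw [hm, ← mul_assoc, ← mul_assoc, hgg]
  have hmg : m * g = m := by rw [hm, mul_assoc, hgg]
  have hagm : g * a * m = g := by
    calc g * a * m = (g * a * g) * m := by rw [mul_assoc (g * a), hgm]
      _ = g * (d * w) * g := by rw [← hgd, hm, hgw]; simp only [mul_assoc, hgg]
      _ = g := by rw [hdw, mul_one, hgg]
  have hmam : m * a * m = m := by
    calc m * a * m = m * g * a * m := by rw [hmg]
      _ = m * (g * a * m) := by simp only [mul_assoc]
      _ = m := by rw [hagm, hmg]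
  obtain ⟨s, hs⟩ := exists_eq_mul_mul_star_of_nonneg hf hm0
  -- A projection below `1 - e`, because `m (f r f) m = m a m = m`.
  set h := r * (f * m * f) * r with hh
  have hteq : (r * s) * f * star (r * s) = h := by
    rw [hh, hs, star_mul, hrs]; simp only [mul_assoc]
  have hhh : h * h = h := by
    calc h * h = r * f * (m * (f * (r * r) * f) * m) * f * r := by
          rw [hh]; simp only [mul_assoc]
      _ = h := by rw [hrr', ← ha, hmam, hh]; simp only [mul_assoc]
  have hhs : star h = h := by
    rw [hh]; simp only [star_mul, hrs, hfs, hms, mul_assoc]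
  have heh : e * h = 0 := by
    rw [hh, ← mul_assoc, ← mul_assoc, her, zero_mul, zero_mul]
  have hhe : h * e = 0 := by rw [hh, mul_assoc _ r e, hre, mul_zero]
  have hproj : IsStarProjection (e + h) := by
    refine ⟨?_, ?_⟩
    · change (e + h) * (e + h) = e + h
      rw [add_mul, mul_add, mul_add, hee, hhh, heh, hhe, add_zero, zero_add]
    · change star (e + h) = e + h
      rw [star_add, hes, hhs]
  refine ⟨r * s, ?_, ?_, ?_⟩ <;> rw [hteq]
  · exact hproj
  · have := mul_mul_mem_closedIdealOf (e + h) e 1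
    rwa [mul_one, mul_add, hee, heh, add_zero] at this
  · apply hf.mem_closedIdealOf_of_norm_lt
    have hdiff : f - f * (e + h) * f = a - a * m * a := by
      have e1 : e = 1 - r := by rw [hr]; abel
      calc f - f * (e + h) * f = (f - f * f) + f * r * f - f * r * f * m * (f * r * f) := by
            rw [hh, e1]; noncomm_ring
        _ = _ := by rw [hff, sub_self, zero_add]
    have hmag : m * a * g = g := by
      have := congrArg star hagm
      simpa only [star_mul, hms, hgs, ha0.isSelfAdjoint.star_eq, mul_assoc] using this
    -- Adding `h` removes the part of `a` seen by `g`; what remains is at most `(1 - g) a (1 - g)`,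
    -- of norm at most 3/4.
    have hcut : a - a * m * a = (1 - g) * (a - a * m * a) * (1 - g) := by
      have c1 : g * (a - a * m * a) = 0 := by
        rw [mul_sub, ← mul_assoc g (a * m), ← mul_assoc g a m, hagm, sub_self]
      have c2 : (a - a * m * a) * g = 0 := by
        rw [sub_mul, mul_assoc a m a, mul_assoc a (m * a), hmag, sub_self]
      rw [sub_mul, one_mul, c1, sub_zero, mul_sub, mul_one, c2, sub_zero]
    have hnonneg : 0 ≤ f - f * (e + h) * f := by
      have := hf.isSelfAdjoint.conjugate_nonneg hproj.one_sub.nonneg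
      rwa [mul_sub, sub_mul, mul_one, hff] at this
    have hle : f - f * (e + h) * f ≤ algebraMap ℝ A (3 * (1 / 4)) := by
      rw [hdiff, hcut]
      have hama : a - a * m * a ≤ a :=
        sub_le_self _ (ha0.isSelfAdjoint.conjugate_nonneg hm0)
      refine (IsSelfAdjoint.conjugate_le_conjugate hama hg.one_sub.isSelfAdjoint).trans
        (hup.trans ?_)
      rw [Algebra.algebraMap_eq_smul_one]
      exact smul_le_smul_of_nonneg_left (sub_le_self _ hg.nonneg) (by norm_num)
    refine ((CStarAlgebra.norm_le_iff_le_algebraMap _ (by norm_num) hnonneg).2 hle).trans_lt ?_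
    norm_num

/-- In real rank zero, finitely many projections are generated by one projection that is a sum of
conjugates of them. -/
theorem HasRealRankZero.exists_sum_conj_isStarProjection (hrr : HasRealRankZero A) {f : ℕ → A}
    (hf : ∀ k, IsStarProjection (f k)) (n : ℕ) :
    ∃ t : ℕ → A, IsStarProjection (∑ k ∈ Finset.range n, t k * f k * star (t k)) ∧
      ∀ k < n, f k ∈ closedIdealOf (∑ k ∈ Finset.range n, t k * f k * star (t k)) := by
  induction n with
  | zero => exact ⟨0, by simp, by simp⟩
  | succ n ih =>
    obtain ⟨t, ht, hmem⟩ := ih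
    obtain ⟨s, hs, he, hfn⟩ := hrr.exists_add_conj_isStarProjection ht (hf n)
    have hsum : ∑ k ∈ Finset.range (n + 1),
          Function.update t n s k * f k * star (Function.update t n s k) =
        ∑ k ∈ Finset.range n, t k * f k * star (t k) + s * f n * star s := by
      rw [Finset.sum_range_succ, Function.update_self]
      congr 1
      refine Finset.sum_congr rfl fun k hk => ?_
      rw [Function.update_of_ne (Finset.mem_range.1 hk).ne]
    refine ⟨Function.update t n s, ?_, ?_⟩ <;> rw [hsum]
    · exact hs
    · intro k hk
      rcases Nat.lt_succ_iff_lt_or_eq.1 hk with hk | rfl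
      · exact mem_closedIdealOf_trans (hmem k hk) he
      · exact hfn

end RealRankZero

/-! ### Conjugation in the crossed product. -/

theorem IsStarProjection.iterate_map {A : Type u} [CStarAlgebra A] (φ : A →⋆ₙₐ[ℂ] A) {e : A}
    (he : IsStarProjection e) (k : ℕ) : IsStarProjection (φ^[k] e) := by
  induction k with
  | zero => exact he
  | succ k ih =>
    rw [Function.iterate_succ_apply']
    exact ih.map φ

theorem Stacey.ι_iterate {A : Type u} [CStarAlgebra A] (β : A →⋆ₙₐ[ℂ] A) (k : ℕ) (a : A) :
    ι β (β^[k] a) = V β ^ k * ι β a * star (V β ^ k) := by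
  induction k with
  | zero => simp
  | succ k ih =>
    rw [Function.iterate_succ_apply', ι_covariant, ih, pow_succ', star_mul]
    simp only [mul_assoc]

/-- If the `e k` are orthogonal subprojections of `p`, then the sum of the elements
`x k * e k * star (x k)` is a conjugate of `p`. -/
theorem sum_mul_mul_star_sum_eq {R : Type*} [Ring R] [StarRing R] {p : R} {e : ℕ → R}
    (he : ∀ k, IsStarProjection (e k)) (hpe : ∀ k, p * e k = e k)
    (horth : ∀ i j, i ≠ j → e i * e j = 0) (x : ℕ → R) (n : ℕ) :
    (∑ k ∈ Finset.range n, x k * e k) * p * star (∑ k ∈ Finset.range n, x k * e k) =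
      ∑ k ∈ Finset.range n, x k * e k * star (x k) := by
  rw [star_sum, Finset.sum_mul, Finset.sum_mul]
  refine Finset.sum_congr rfl fun k hk => ?_
  rw [Finset.mul_sum, Finset.sum_eq_single k]
  · rw [star_mul, (he k).isSelfAdjoint.star_eq, ← mul_assoc, mul_assoc _ p, hpe, mul_assoc (x k),
      (he k).isIdempotentElem.eq]
  · intro j _ hj
    rw [star_mul, (he j).isSelfAdjoint.star_eq, ← mul_assoc, mul_assoc _ p, hpe, mul_assoc (x k),
      horth k j hj.symm, mul_zero, zero_mul]
  · exact fun h => absurd hk h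

theorem mainTheorem10 {A : Type u} [CStarAlgebra A] [PartialOrder A] [StarOrderedRing A]
    (hrr : HasRealRankZero A) (hdagger : SatisfiesDagger A)
    (β : A →⋆ₙₐ[ℂ] A) (hβ : Function.Injective β)
    (hher : IsHereditarySubalgebra (NonUnitalStarAlgHom.range β))
    (hideal : ∀ I : TwoSidedIdeal A, IsClosed (I : Set A) → (∀ a ∈ I, β a ∈ I) →
      I = ⊥ ∨ I = ⊤)
    (p : A) (hp : IsStarProjection p) (hp0 : p ≠ 0) :
    ∃ q : A, IsStarProjection q ∧ IsFullElement q ∧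
      ∃ c : Stacey.CrossedProduct β,
        Stacey.ι β q = c * Stacey.ι β p * star c := by
  obtain ⟨n, hn⟩ := exists_forall_isFullElement_of_iterate_mem β hideal hp0
  obtain ⟨e₀, he₀, horth₀⟩ := hdagger n p hp hp0
  -- Padding by 0 keeps orthogonal subprojections of `p` while indexing by `ℕ`, as the exponents of
  -- `β` and `V` require.
  let e : ℕ → A := fun k => if h : k < n then e₀ ⟨k, h⟩ else 0
  have he : ∀ k, IsStarProjection (e k) := fun k => by
    by_cases h : k < n
    · simpa [e, h] using (he₀ ⟨k, h⟩).1
    · simp [e, h]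
  have hpe : ∀ k, p * e k = e k := fun k => by
    by_cases h : k < n
    · simpa [e, h] using (he₀ ⟨k, h⟩).2.2.1
    · simp [e, h]
  have hmem : ∀ k < n, p ∈ closedIdealOf (e k) := fun k h => by
    simpa [e, h] using (he₀ ⟨k, h⟩).2.2.2
  have horth : ∀ i j, i ≠ j → e i * e j = 0 := fun i j hij => by
    by_cases hi : i < n
    · by_cases hj : j < n
      · simpa [e, hi, hj] using horth₀ ⟨i, hi⟩ ⟨j, hj⟩ (by simpa using hij)
      · simp [e, hj]
    · simp [e, hi]
  obtain ⟨t, hproj, hgen⟩ := hrr.exists_sum_conj_isStarProjection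
    (f := fun k => β^[k] (e k)) (fun k => (he k).iterate_map β k) n
  refine ⟨_, hproj, hn _ fun k hk => ?_,
    ∑ k ∈ Finset.range n, Stacey.ι β (t k) * Stacey.V β ^ k * Stacey.ι β (e k), ?_⟩
  · exact mem_closedIdealOf_trans (iterate_map_mem_closedIdealOf β (hmem k hk) k) (hgen k hk)
  · rw [sum_mul_mul_star_sum_eq (p := Stacey.ι β p) (e := fun k => Stacey.ι β (e k))
      (fun k => (he k).map (Stacey.ι β)) (fun k => by rw [← map_mul, hpe])
      (fun i j hij => by rw [← map_mul, horth i j hij, map_zero]), map_sum]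
    refine Finset.sum_congr rfl fun k _ => ?_
    rw [map_mul, map_mul, map_star, Stacey.ι_iterate, star_mul]
    simp only [mul_assoc]
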